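/- **Setting.** Let $S_0\subset\mathbb R^2$ be an axis-aligned square of side length $x>0$, and let $\mathcal A=\{S_1,\dots,S_k\}$ be a packing of $S_0$: finitely many unit squares, of arbitrary orientation, contained in $S_0$ and with pairwise disjoint interiors. For $i\ge 1$ let $S_i^*$ be the set of points on the boundary of $S_i$ or inside it; let $S_0^*$ be the set of points on the boundary of $S_0$ or outside it. For a measurable set $A\subseteq\mathbb R^2$ let $$W(A)=\bigl|A\setminus(S_0^*\cup S_1^*\cup\dots\cup S_k^*)\bigr|$$ be the wasted area in $A$, i.e. the area of the part of $A$ that lies inside $S_0$ and is covered by no unit square. For two squares $S,T$ let $\theta(S,T)\in[0,\pi/4]$ be the smallest angle, in radians, of a rotation (clockwise or counterclockwise) of $S$ after which some edge of $S$ is parallel to some edge of $T$. For $S\subseteq\mathbb R^2$ let $B(S,r)$ be the set of points at distance less than $r$ from $S$. Let $c=10^{-10}$. **Proposition.** Put $r=5$ and $c'=c/1600$. For every such $S_0$ and every packing $\mathcal A=\{S_1,\dots,S_k\}$ of $S_0$, for all $a,b\in\{0,1,\dots,k\}$, and for every continuous path $\gamma\colon[s,t]\to\mathbb R^2$ $(s<t)$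 with $\gamma(s)\in S_a^*$ and $\gamma(t)\in S_b^*$ (in particular for every path from a point of the boundary of $S_a$ to a point of the boundary of $S_b$), $$W\bigl(B(\operatorname{im}\gamma,r)\bigr)\;\ge\;c'\cdot\theta(S_a,S_b).$$ In particular the constants $r>0$ and $c'>0$ are absolute: they depend on none of $S_0$, $\mathcal A$, $a$, $b$, $\gamma$. -/

import Mathlib

open MeasureTheory Set

noncomputable section

/-- The Euclidean plane `ℝ²` with its Euclidean distance and Lebesgue measure. -/
abbrev Plane : Type := EuclideanSpace ℝ (Fin 2)

/-- The unit vector at angle `t` (counterclockwise, from the positive first axis). -/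
def dir (t : ℝ) : Plane := !₂[Real.cos t, Real.sin t]

/-- A square in the plane, given by a corner, the direction of an edge at that corner (the square
lies to the left of this edge), and its side length. -/
structure Square where
  corner : Plane
  angle : ℝ
  side : ℝ
  side_pos : 0 < side

namespace Square

/-- The points on the boundary of the square and inside it. -/
def filled (S : Square) : Set Plane :=
  {p | ∃ u ∈ Icc 0 S.side, ∃ v ∈ Icc 0 S.side,
    p = S.corner + u • dir S.angle + v • dir (S.angle + Real.pi / 2)}

/-- The square as a set of points of the plane, that is, the points on its boundary. -/
def boundary (S : Square) : Set Plane := frontier S.filled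

/-- The directions of the edges of the square. -/
def edgeDirs (S : Square) : Set Plane := {dir S.angle, dir (S.angle + Real.pi / 2)}

/-- Some edge of `S` is parallel to some edge of `T`. -/
def SameOrientation (S T : Square) : Prop :=
  ∃ e ∈ S.edgeDirs, ∃ f ∈ T.edgeDirs, ∃ r : ℝ, e = r • f

/-- The square rotated about its corner by the angle `φ`; negative `φ` is a clockwise rotation. -/
def rotate (S : Square) (φ : ℝ) : Square := { S with angle := S.angle + φ }

/-- The angle between two squares: the minimum angle of a rotation, in either direction, after
which `S` has the same orientation as `T`. -/
def theta (S T : Square) : ℝ :=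
  sInf {α : ℝ | ∃ φ : ℝ, α = |φ| ∧ (S.rotate φ).SameOrientation T}

end Square

/-- A packing of `S₀`: finitely many non-overlapping unit squares contained in `S₀`. -/
structure Packing (S₀ : Square) where
  count : ℕ
  unitSquare : Fin count → Square
  side_eq_one : ∀ i, (unitSquare i).side = 1
  subset_large : ∀ i, (unitSquare i).filled ⊆ S₀.filled
  nonoverlapping : ∀ i j, i ≠ j →
    Disjoint (interior (unitSquare i).filled) (interior (unitSquare j).filled)

namespace Packing

variable {S₀ : Square}

/-- The squares `S₀, S₁, …, S_k`: the index `none` is the large square, `some i` a unit square. -/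
def square (P : Packing S₀) : Option (Fin P.count) → Square
  | none => S₀
  | some i => P.unitSquare i

/-- `S_i^*`: for a unit square the points on its boundary and inside it, for the large square the
points on its boundary and outside it. -/
def star (P : Packing S₀) : Option (Fin P.count) → Set Plane
  | none => S₀.boundary ∪ S₀.filledᶜ
  | some i => (P.unitSquare i).filled

/-- The wasted area in `A`: the area of the part of `A` inside the large square that is not covered
by a unit square. It is finite for every `A`, as this part lies in the large square. -/
def waste (P : Packing S₀) (A : Set Plane) : ℝ :=
  volume.real (A \ ⋃ i, P.star i)

end Packing

end

/-! Let f(m) be the angle between S_a and S_m, so f(a) = 0. If the waste near the path is at least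
π·10⁻¹², the bound is immediate, as angles are at most π/4. Otherwise every point within 2 of the
path has a star within ρ = 10⁻⁶ (`exists_star_inter_ball`).

Fix a level l in [0, f(b)). By connectedness some point of the path is close both to a star with f ≤
l and to one with f > l. Each contains a disc of radius 1/2 nearby. Only boundedly many corners are
around, so some segment joining the discs avoids them all. Connectedness along it gives a point q,
close to stars i, k of the two classes, around which every star is locally empty, full or a
half-plane (`exists_facingAt`).

Two disjoint half-planes that almost reach q have nearly opposite normals. Their tilt forces a gap
of area at least a constant times its sine, hence times f(k) - f(i) (`exists_gap`,
`theta_le_theta_add_sin`), and no third star fits nearby (`not_third`), so gaps of different pairs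
are disjoint. The intervals [f(i), f(k)) cover [0, f(b)), so the gap areas add up to a constant
times f(b) (`mul_theta_le_waste`). -/

/-! ### Rotated orthonormal frames -/

lemma inner_dir_right (p : Plane) (t : ℝ) :
    inner ℝ p (dir t) = p 0 * Real.cos t + p 1 * Real.sin t := by
  simp [dir, PiLp.inner_apply, Fin.sum_univ_two]; ring

lemma inner_dir_dir (s t : ℝ) : inner ℝ (dir s) (dir t) = Real.cos (s - t) := by
  rw [inner_dir_right, Real.cos_sub]; simp [dir]

lemma inner_dir_self (t : ℝ) : inner ℝ (dir t) (dir t) = 1 := by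
  rw [inner_dir_dir, sub_self, Real.cos_zero]

lemma norm_dir (t : ℝ) : ‖dir t‖ = 1 := by
  have h := real_inner_self_eq_norm_sq (dir t)
  rw [inner_dir_self] at h
  nlinarith [norm_nonneg (dir t)]

lemma dir_add_pi (t : ℝ) : dir (t + Real.pi) = -dir t := by
  ext i; fin_cases i <;> simp [dir]

lemma inner_dir_perp (t : ℝ) : inner ℝ (dir t) (dir (t + Real.pi / 2)) = 0 := by
  simp [inner_dir_dir]

lemma inner_perp_dir (t : ℝ) : inner ℝ (dir (t + Real.pi / 2)) (dir t) = 0 := by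
  simp [inner_dir_dir]

/-- Expansion of a vector in the orthonormal frame at angle `t`. -/
lemma eq_frame_expansion (p : Plane) (t : ℝ) :
    p = inner ℝ p (dir t) • dir t +
      inner ℝ p (dir (t + Real.pi / 2)) • dir (t + Real.pi / 2) := by
  have h := Real.sin_sq_add_cos_sq t
  simp only [inner_dir_right, Real.cos_add_pi_div_two, Real.sin_add_pi_div_two]
  ext i
  fin_cases i
  · simp [dir, Real.cos_add_pi_div_two, Real.sin_add_pi_div_two]
    linear_combination (-p 0) * h
  · simp [dir, Real.cos_add_pi_div_two, Real.sin_add_pi_div_two]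
    linear_combination (-p 1) * h

lemma norm_sq_frame (p : Plane) (t : ℝ) :
    ‖p‖ ^ 2 = inner ℝ p (dir t) ^ 2 + inner ℝ p (dir (t + Real.pi / 2)) ^ 2 := by
  have h := Real.sin_sq_add_cos_sq t
  rw [EuclideanSpace.norm_sq_eq]
  simp [inner_dir_right, Fin.sum_univ_two, Real.cos_add_pi_div_two, Real.sin_add_pi_div_two]
  linear_combination (-(p 0) ^ 2 - (p 1) ^ 2) * h

lemma abs_inner_dir_le (p : Plane) (t : ℝ) : |inner ℝ p (dir t)| ≤ ‖p‖ := by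
  simpa [norm_dir] using abs_real_inner_le_norm p (dir t)

lemma exists_eq_norm_smul_dir (p : Plane) : ∃ t : ℝ, p = ‖p‖ • dir t := by
  let z : ℂ := ⟨p 0, p 1⟩
  have hz : ‖z‖ = ‖p‖ := by
    rw [EuclideanSpace.norm_eq, Complex.norm_def, Complex.normSq_apply]
    simp [Fin.sum_univ_two, z, sq]
  refine ⟨z.arg, ?_⟩
  ext i
  fin_cases i
  · simp [dir, ← hz, Complex.norm_mul_cos_arg, z]
  · simp [dir, ← hz, Complex.norm_mul_sin_arg, z]

/-- The area of an open rectangle, in the frame at angle `t` around `q`. -/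
lemma volume_rectangle (q : Plane) (t x₁ x₂ y₁ y₂ : ℝ) :
    volume {z : Plane | inner ℝ (z - q) (dir t) ∈ Ioo x₁ x₂ ∧
      inner ℝ (z - q) (dir (t + Real.pi / 2)) ∈ Ioo y₁ y₂} =
      ENNReal.ofReal (x₂ - x₁) * ENNReal.ofReal (y₂ - y₁) := by
  have horth : Orthonormal ℝ ![dir t, dir (t + Real.pi / 2)] := by
    rw [orthonormal_iff_ite]
    intro i j
    fin_cases i <;> fin_cases j <;>
      simp [inner_dir_perp, inner_perp_dir, norm_dir]
  let e : Module.Basis (Fin 2) ℝ Plane :=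
    basisOfOrthonormalOfCardEqFinrank horth (by simp)
  have he : ⇑e = ![dir t, dir (t + Real.pi / 2)] := by simp [e]
  let b : OrthonormalBasis (Fin 2) ℝ Plane := e.toOrthonormalBasis (by rw [he]; exact horth)
  have hb : ⇑b = ![dir t, dir (t + Real.pi / 2)] := by simp [b, he]
  have hmp := ((EuclideanSpace.volume_preserving_symm_measurableEquiv_toLp (Fin 2)).comp
    b.measurePreserving_repr).comp (measurePreserving_sub_right volume q)
  have hbox : MeasurableSet (Set.pi univ ![Ioo x₁ x₂, Ioo y₁ y₂]) := by
    refine MeasurableSet.univ_pi fun i => ?_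
    fin_cases i <;> exact measurableSet_Ioo
  have hv := hmp.measure_preimage hbox.nullMeasurableSet
  rw [volume_pi_pi, Fin.prod_univ_two] at hv
  simp only [Matrix.cons_val_zero, Matrix.cons_val_one, Real.volume_Ioo] at hv
  rw [← hv]
  congr 1
  ext z
  have h0 : b.repr (z - q) 0 = inner ℝ (z - q) (dir t) := by
    rw [b.repr_apply_apply, hb, real_inner_comm]; rfl
  have h1 : b.repr (z - q) 1 = inner ℝ (z - q) (dir (t + Real.pi / 2)) := by
    rw [b.repr_apply_apply, hb, real_inner_comm]; rfl
  simp only [mem_ofPred_eq, ← h0, ← h1]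
  simp [Set.mem_pi, Fin.forall_fin_two]

lemma isOpen_rectangle (q : Plane) (t x₁ x₂ y₁ y₂ : ℝ) :
    IsOpen {z : Plane | inner ℝ (z - q) (dir t) ∈ Ioo x₁ x₂ ∧
      inner ℝ (z - q) (dir (t + Real.pi / 2)) ∈ Ioo y₁ y₂} :=
  (isOpen_Ioo.preimage (by fun_prop)).inter (isOpen_Ioo.preimage (by fun_prop))

/-! ### Squares in frame coordinates -/

namespace Square

lemma mem_filled_iff (S : Square) (p : Plane) : p ∈ S.filled ↔
    inner ℝ (p - S.corner) (dir S.angle) ∈ Icc 0 S.side ∧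
      inner ℝ (p - S.corner) (dir (S.angle + Real.pi / 2)) ∈ Icc 0 S.side := by
  constructor
  · rintro ⟨u, hu, v, hv, rfl⟩
    rw [add_assoc, add_sub_cancel_left]
    simpa only [inner_add_left, real_inner_smul_left, inner_dir_self, inner_dir_perp,
      inner_perp_dir, mul_one, mul_zero, add_zero, zero_add] using And.intro hu hv
  · rintro ⟨hu, hv⟩
    refine ⟨_, hu, _, hv, ?_⟩
    rw [add_assoc, ← eq_frame_expansion, add_sub_cancel]

lemma isClosed_filled (S : Square) : IsClosed S.filled := by
  have : S.filled = {p | inner ℝ (p - S.corner) (dir S.angle) ∈ Icc 0 S.side} ∩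
      {p | inner ℝ (p - S.corner) (dir (S.angle + Real.pi / 2)) ∈ Icc 0 S.side} := by
    ext p; exact S.mem_filled_iff p
  rw [this]
  exact (isClosed_Icc.preimage (by fun_prop)).inter (isClosed_Icc.preimage (by fun_prop))

lemma mem_interior_filled_iff (S : Square) (p : Plane) : p ∈ interior S.filled ↔
    inner ℝ (p - S.corner) (dir S.angle) ∈ Ioo 0 S.side ∧
      inner ℝ (p - S.corner) (dir (S.angle + Real.pi / 2)) ∈ Ioo 0 S.side := by
  constructor
  · intro hp
    obtain ⟨ε, hε, hb⟩ := Metric.isOpen_iff.1 isOpen_interior p hp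
    have key : ∀ t σ : ℝ, |σ| = 1 → p + (σ * (ε / 2)) • dir t ∈ S.filled := by
      intro t σ hσ
      refine interior_subset (hb ?_)
      rw [Metric.mem_ball, dist_eq_norm, add_sub_cancel_left, norm_smul, norm_dir, Real.norm_eq_abs,
        abs_mul, hσ, abs_of_pos (half_pos hε)]
      linarith
    have h1 := (S.mem_filled_iff _).1 (key S.angle 1 (by simp))
    have h2 := (S.mem_filled_iff _).1 (key S.angle (-1) (by simp))
    have h3 := (S.mem_filled_iff _).1 (key (S.angle + Real.pi / 2) 1 (by simp))
    have h4 := (S.mem_filled_iff _).1 (key (S.angle + Real.pi / 2) (-1) (by simp))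
    simp only [add_sub_right_comm, inner_add_left, real_inner_smul_left, inner_dir_self,
      inner_dir_perp, inner_perp_dir, mem_Icc] at h1 h2 h3 h4
    refine ⟨⟨?_, ?_⟩, ⟨?_, ?_⟩⟩ <;> linarith [h1.1.1, h1.1.2, h2.1.1, h2.1.2, h3.2.1, h3.2.2,
      h4.2.1, h4.2.2]
  · intro hp
    have hopen : IsOpen {z : Plane | inner ℝ (z - S.corner) (dir S.angle) ∈ Ioo 0 S.side ∧
      inner ℝ (z - S.corner) (dir (S.angle + Real.pi / 2)) ∈ Ioo 0 S.side} :=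
      isOpen_rectangle _ _ _ _ _ _
    refine mem_interior.2 ⟨_, ?_, hopen, hp⟩
    intro z hz
    exact (S.mem_filled_iff z).2 ⟨Ioo_subset_Icc_self hz.1, Ioo_subset_Icc_self hz.2⟩

/-- The center of a square. -/
noncomputable def center (S : Square) : Plane :=
  S.corner + (S.side / 2) • dir S.angle + (S.side / 2) • dir (S.angle + Real.pi / 2)

lemma inner_sub_center (S : Square) (p : Plane) :
    inner ℝ (p - S.center) (dir S.angle) =
      inner ℝ (p - S.corner) (dir S.angle) - S.side / 2 ∧
    inner ℝ (p - S.center) (dir (S.angle + Real.pi / 2)) =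
      inner ℝ (p - S.corner) (dir (S.angle + Real.pi / 2)) - S.side / 2 := by
  have : p - S.center = (p - S.corner) - (S.side / 2) • dir S.angle -
      (S.side / 2) • dir (S.angle + Real.pi / 2) := by
    unfold center; abel
  rw [this]
  simp only [inner_sub_left, real_inner_smul_left, inner_dir_self, inner_dir_perp, inner_perp_dir]
  constructor <;> ring

lemma ball_center_subset (S : Square) :
    Metric.ball S.center (S.side / 2) ⊆ interior S.filled := by
  intro p hp
  rw [Metric.mem_ball, dist_eq_norm] at hp
  obtain ⟨h1, h2⟩ := S.inner_sub_center p
  have h3 := abs_lt.1 ((abs_inner_dir_le (p - S.center) S.angle).trans_lt hp)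
  have h4 := abs_lt.1 ((abs_inner_dir_le (p - S.center) (S.angle + Real.pi / 2)).trans_lt hp)
  rw [S.mem_interior_filled_iff]
  exact ⟨⟨by linarith [h3.1], by linarith [h3.2]⟩, ⟨by linarith [h4.1], by linarith [h4.2]⟩⟩

lemma dist_center_le (S : Square) {p : Plane} (hp : p ∈ S.filled) :
    dist p S.center ≤ S.side := by
  obtain ⟨h1, h2⟩ := S.inner_sub_center p
  obtain ⟨⟨h3, h4⟩, ⟨h5, h6⟩⟩ := (S.mem_filled_iff p).1 hp
  have h := norm_sq_frame (p - S.center) S.angle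
  rw [h1, h2] at h
  rw [dist_eq_norm]
  refine abs_le_of_sq_le_sq' ?_ S.side_pos.le |>.2
  rw [h]
  nlinarith

lemma isBounded_filled (S : Square) : Bornology.IsBounded S.filled :=
  Metric.isBounded_closedBall.subset fun _ hp => S.dist_center_le hp

/-- The four corners of a square. -/
noncomputable def corners (S : Square) : Finset Plane :=
  open Classical in
  {S.corner, S.corner + S.side • dir S.angle,
    S.corner + S.side • dir (S.angle + Real.pi / 2),
    S.corner + S.side • dir S.angle + S.side • dir (S.angle + Real.pi / 2)}

lemma card_corners_le (S : Square) : S.corners.card ≤ 4 := by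
  classical
  exact Finset.card_le_four

/-! ### Orientations and the angle between squares -/

lemma sameOrientation_iff (S T : Square) :
    S.SameOrientation T ↔ ∃ j : ℤ, S.angle - T.angle = j * (Real.pi / 2) := by
  constructor
  · rintro ⟨e, he, f, hf, c, hc⟩
    have key : ∀ s t : ℝ, dir s = c • dir t → ∃ j : ℤ, s - t = j * Real.pi := by
      intro s t h
      have h1 : inner ℝ (dir s) (dir (t + Real.pi / 2)) = 0 := by
        rw [h, real_inner_smul_left, inner_dir_perp, mul_zero]
      rw [inner_dir_dir, show s - (t + Real.pi / 2) = (s - t) - Real.pi / 2 by ring,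
        Real.cos_sub_pi_div_two, Real.sin_eq_zero_iff] at h1
      obtain ⟨j, hj⟩ := h1
      exact ⟨j, hj.symm⟩
    rcases he with rfl | rfl <;> rcases hf with rfl | rfl <;> obtain ⟨j, hj⟩ := key _ _ hc
    · exact ⟨2 * j, by push_cast; linarith⟩
    · exact ⟨2 * j + 1, by push_cast; linarith⟩
    · exact ⟨2 * j - 1, by push_cast; linarith⟩
    · exact ⟨2 * j, by push_cast; linarith⟩
  · rintro ⟨j, hj⟩
    have key : ∀ (s t : ℝ) (m : ℤ), s - t = m * Real.pi → ∃ c : ℝ, dir s = c • dir t := by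
      intro s t m h
      refine ⟨inner ℝ (dir s) (dir t), ?_⟩
      have h1 := eq_frame_expansion (dir s) t
      have h2 : inner ℝ (dir s) (dir (t + Real.pi / 2)) = 0 := by
        rw [inner_dir_dir, show s - (t + Real.pi / 2) = (s - t) - Real.pi / 2 by ring,
          Real.cos_sub_pi_div_two, h, Real.sin_int_mul_pi]
      rwa [h2, zero_smul, add_zero] at h1
    obtain ⟨m, hm⟩ := Int.even_or_odd' j
    rcases hm with rfl | rfl
    · obtain ⟨c, hc⟩ := key S.angle T.angle m (by rw [hj]; push_cast; ring)
      exact ⟨_, Or.inl rfl, _, Or.inl rfl, c, hc⟩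
    · obtain ⟨c, hc⟩ := key S.angle (T.angle + Real.pi / 2) m (by
        rw [← sub_sub, hj]; push_cast; ring)
      exact ⟨_, Or.inl rfl, _, Or.inr rfl, c, hc⟩

lemma theta_le_abs (S T : Square) (φ : ℝ) (j : ℤ)
    (h : S.angle + φ - T.angle = j * (Real.pi / 2)) : S.theta T ≤ |φ| :=
  csInf_le ⟨0, by rintro _ ⟨φ, rfl, _⟩; exact abs_nonneg φ⟩
    ⟨φ, rfl, (sameOrientation_iff _ _).2 ⟨j, h⟩⟩

lemma theta_self (S : Square) : S.theta S = 0 := by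
  refine le_antisymm (by simpa using S.theta_le_abs S 0 0 (by simp)) ?_
  exact Real.sInf_nonneg (by rintro _ ⟨φ, rfl, _⟩; exact abs_nonneg φ)

lemma theta_le_pi_div_four (S T : Square) : S.theta T ≤ Real.pi / 4 := by
  set x := (S.angle - T.angle) / (Real.pi / 2) with hx
  have hpi := Real.pi_pos
  have hx' : S.angle - T.angle = x * (Real.pi / 2) := by rw [hx]; field_simp
  have h := S.theta_le_abs T ((round x - x) * (Real.pi / 2)) (round x) (by linarith)
  have h1 := abs_sub_round x
  rw [abs_mul, abs_sub_comm, abs_of_pos (half_pos hpi)] at h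
  nlinarith

/-- A rotation φ aligning S with T becomes, after correction by δ, one aligning S with T'; so the
angle is 1-Lipschitz in the orientation of the second square. -/
lemma theta_le_theta_add (S T T' : Square) (δ : ℝ) (j : ℤ)
    (h : T'.angle + δ - T.angle = j * (Real.pi / 2)) : S.theta T' ≤ S.theta T + |δ| := by
  rw [← sub_le_iff_le_add]
  refine le_csInf ⟨_, T.angle - S.angle, rfl, (sameOrientation_iff _ _).2 ⟨0, ?_⟩⟩ ?_
  · simp [rotate]
  · rintro _ ⟨φ, rfl, hφ⟩
    obtain ⟨m, hm⟩ := (sameOrientation_iff _ _).1 hφ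
    have hm' : S.angle + φ - T.angle = m * (Real.pi / 2) := hm
    have h1 := S.theta_le_abs T' (φ - δ) (m - j) (by push_cast; linarith)
    have h2 := abs_sub φ δ
    linarith

/-- The angle function changes by at most a multiple of the sine of the angle between two edges. -/
lemma theta_le_theta_add_sin (S T T' : Square) (i j : ℤ) :
    S.theta T' ≤ S.theta T + Real.pi / 2 *
      |Real.sin ((T.angle + i * (Real.pi / 2)) - (T'.angle + j * (Real.pi / 2)))| := by
  set ω := (T.angle + i * (Real.pi / 2)) - (T'.angle + j * (Real.pi / 2)) with hω
  have hpi := Real.pi_pos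
  -- Only ω modulo π matters; the representative δ with |δ| ≤ π/2 admits Jordan's inequality.
  set m := round (ω / Real.pi) with hm
  set δ := ω - m * Real.pi with hδ
  have h1 := S.theta_le_theta_add T T' δ (i - j - 2 * m) (by push_cast; linarith)
  have h2 : |δ| ≤ Real.pi / 2 := by
    have h3 := abs_sub_round (ω / Real.pi)
    have h4 : δ = (ω / Real.pi - m) * Real.pi := by rw [hδ]; field_simp
    rw [h4, abs_mul, abs_of_pos hpi]
    nlinarith
  have h3 : |Real.sin ω| = |Real.sin δ| := by
    rw [hδ, Real.sin_sub_int_mul_pi, abs_mul, abs_zpow]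
    simp
  have h4 : 2 / Real.pi * |δ| ≤ |Real.sin δ| := by
    have h5 := Real.mul_le_sin (abs_nonneg δ) h2
    refine h5.trans ?_
    rcases abs_cases δ with ⟨h, _⟩ | ⟨h, _⟩
    · rw [h]; exact le_abs_self _
    · rw [h, Real.sin_neg]; exact neg_le_abs _
  rw [h3]
  have h6 : |δ| = Real.pi / 2 * (2 / Real.pi * |δ|) := by field_simp
  have h7 : Real.pi / 2 * (2 / Real.pi * |δ|) ≤ Real.pi / 2 * |Real.sin δ| :=
    mul_le_mul_of_nonneg_left h4 (by positivity)
  linarith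

end Square

/-! ### Local half-planes -/

/-- In the ball of radius `r` around `q`, the closed set `K` with interior `U` is empty, everything,
or a half-plane whose boundary is parallel to an edge of a square at angle `α`. -/
def LocallyHalfPlane (K U : Set Plane) (q : Plane) (r α : ℝ) : Prop :=
  (∀ z ∈ Metric.ball q r, z ∉ K) ∨ (∀ z ∈ Metric.ball q r, z ∈ U) ∨
    ∃ (j : ℤ) (h : ℝ), ∀ z ∈ Metric.ball q r,
      (z ∈ K ↔ inner ℝ (z - q) (dir (α + j * (Real.pi / 2))) ≤ h) ∧
      (z ∈ U ↔ inner ℝ (z - q) (dir (α + j * (Real.pi / 2))) < h)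

/-- Two quarter turns reverse the normal. This handles the star of the large square, which is the
complement of its interior. -/
lemma LocallyHalfPlane.compl {K U : Set Plane} {q : Plane} {r α : ℝ}
    (H : LocallyHalfPlane K U q r α) : LocallyHalfPlane Uᶜ Kᶜ q r α := by
  rcases H with H | H | ⟨j, h, H⟩
  · exact Or.inr (Or.inl H)
  · exact Or.inl fun z hz hn => hn (H z hz)
  · refine Or.inr (Or.inr ⟨j + 2, -h, fun z hz => ?_⟩)
    have e : α + ((j + 2 : ℤ) : ℝ) * (Real.pi / 2) = α + j * (Real.pi / 2) + Real.pi := by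
      push_cast; ring
    rw [e, dir_add_pi, inner_neg_right, neg_le_neg_iff, neg_lt_neg_iff, mem_compl_iff,
      mem_compl_iff, (H z hz).1, (H z hz).2, not_le, not_lt]
    exact ⟨Iff.rfl, Iff.rfl⟩

namespace Square

/-- Away from its corners a square is locally a half-plane. -/
lemma locallyHalfPlane (S : Square) (q : Plane) {r : ℝ} (hr : 0 < r) (hS : 4 * r < S.side)
    (hq : ∀ x ∈ S.corners, 4 * r ≤ dist q x) :
    LocallyHalfPlane S.filled (interior S.filled) q r S.angle := by
  classical
  set X := inner ℝ (q - S.corner) (dir S.angle) with hX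
  set Y := inner ℝ (q - S.corner) (dir (S.angle + Real.pi / 2)) with hY
  -- If both coordinates were within 2r of the corner, the distance would be below √8·r < 4r.
  have hc : ∀ a b : ℝ, S.corner + a • dir S.angle + b • dir (S.angle + Real.pi / 2) ∈ S.corners →
      2 * r ≤ |X - a| ∨ 2 * r ≤ |Y - b| := by
    intro a b hm
    have h1 := hq _ hm
    have e : q - (S.corner + a • dir S.angle + b • dir (S.angle + Real.pi / 2)) =
      (q - S.corner) - a • dir S.angle - b • dir (S.angle + Real.pi / 2) := by abel
    have h2 := norm_sq_frame (q - (S.corner + a • dir S.angle +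
      b • dir (S.angle + Real.pi / 2))) S.angle
    rw [← dist_eq_norm, e] at h2
    simp only [inner_sub_left, real_inner_smul_left, inner_dir_self, inner_dir_perp,
      inner_perp_dir, mul_one, mul_zero, sub_zero] at h2
    rw [← inner_sub_left, ← inner_sub_left, ← hX, ← hY, ← sq_abs (X - a), ← sq_abs (Y - b)] at h2
    by_contra! hcon
    nlinarith [hcon.1, hcon.2, abs_nonneg (X - a), abs_nonneg (Y - b)]
  have c00 := hc 0 0 (by simp [corners])
  have c10 := hc S.side 0 (by simp [corners])
  have c01 := hc 0 S.side (by simp [corners])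
  have c11 := hc S.side S.side (by simp [corners])
  rw [sub_zero] at c00 c10 c01
  rw [sub_zero] at c00
  have hz : ∀ z ∈ Metric.ball q r,
      |inner ℝ (z - q) (dir S.angle)| < r ∧
      |inner ℝ (z - q) (dir (S.angle + Real.pi / 2))| < r ∧
      inner ℝ (z - S.corner) (dir S.angle) = inner ℝ (z - q) (dir S.angle) + X ∧
      inner ℝ (z - S.corner) (dir (S.angle + Real.pi / 2)) =
        inner ℝ (z - q) (dir (S.angle + Real.pi / 2)) + Y := by
    intro z hz
    rw [Metric.mem_ball, dist_eq_norm] at hz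
    refine ⟨(abs_inner_dir_le _ _).trans_lt hz, (abs_inner_dir_le _ _).trans_lt hz, ?_, ?_⟩
    · rw [hX, ← inner_add_left, sub_add_sub_cancel]
    · rw [hY, ← inner_add_left, sub_add_sub_cancel]
  have e0 : S.angle + ((0 : ℤ) : ℝ) * (Real.pi / 2) = S.angle := by simp
  have e1 : S.angle + ((1 : ℤ) : ℝ) * (Real.pi / 2) = S.angle + Real.pi / 2 := by simp
  have e2 : S.angle + ((2 : ℤ) : ℝ) * (Real.pi / 2) = S.angle + Real.pi := by push_cast; ring
  have e3 : S.angle + ((3 : ℤ) : ℝ) * (Real.pi / 2) = S.angle + Real.pi / 2 + Real.pi := by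
    push_cast; ring
  unfold LocallyHalfPlane
  simp only [mem_filled_iff, mem_interior_filled_iff, mem_Icc, mem_Ioo]
  by_cases hout : X ≤ -(2 * r) ∨ S.side + 2 * r ≤ X ∨ Y ≤ -(2 * r) ∨ S.side + 2 * r ≤ Y
  · left
    rintro z hzb ⟨⟨h1, h2⟩, h3, h4⟩
    obtain ⟨hx, hy, hx', hy'⟩ := hz z hzb
    rw [abs_lt] at hx hy
    rw [hx'] at h1 h2
    rw [hy'] at h3 h4
    rcases hout with h | h | h | h <;> linarith [hx.1, hx.2, hy.1, hy.2]
  · right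
    push Not at hout
    obtain ⟨o1, o2, o3, o4⟩ := hout
    simp only [le_abs'] at c00 c10 c01 c11
    -- Near one edge, the corner conditions keep `q` away from both ends of that edge, and 4r < side
    -- keeps it away from the opposite edge. The index 0, 1, 2, 3 selects the outward normal of the
    -- edge.
    by_cases n1 : X < 2 * r
    · have hY1 : 2 * r ≤ Y ∧ Y ≤ S.side - 2 * r := by
        clear hz hc hq
        clear_value X Y
        grind
      refine Or.inr ⟨2, X, fun z hzb => ?_⟩
      obtain ⟨hx, hy, hx', hy'⟩ := hz z hzb
      rw [e2, dir_add_pi, inner_neg_right, hx', hy']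
      rw [abs_lt] at hx hy
      obtain ⟨hx1, hx2⟩ := hx
      obtain ⟨hy1, hy2⟩ := hy
      exact ⟨⟨fun h => by linarith [h.1.1],
        fun h => ⟨⟨by linarith, by linarith⟩, by linarith, by linarith⟩⟩,
        fun h => by linarith [h.1.1],
        fun h => ⟨⟨by linarith, by linarith⟩, by linarith, by linarith⟩⟩
    by_cases n2 : S.side - 2 * r < X
    · have hY1 : 2 * r ≤ Y ∧ Y ≤ S.side - 2 * r := by
        clear hz hc hq
        clear_value X Y
        grind
      refine Or.inr ⟨0, S.side - X, fun z hzb => ?_⟩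
      obtain ⟨hx, hy, hx', hy'⟩ := hz z hzb
      rw [e0, hx', hy']
      rw [abs_lt] at hx hy
      obtain ⟨hx1, hx2⟩ := hx
      obtain ⟨hy1, hy2⟩ := hy
      exact ⟨⟨fun h => by linarith [h.1.2],
        fun h => ⟨⟨by linarith, by linarith⟩, by linarith, by linarith⟩⟩,
        fun h => by linarith [h.1.2],
        fun h => ⟨⟨by linarith, by linarith⟩, by linarith, by linarith⟩⟩
    by_cases n3 : Y < 2 * r
    · refine Or.inr ⟨3, Y, fun z hzb => ?_⟩
      obtain ⟨hx, hy, hx', hy'⟩ := hz z hzb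
      rw [e3, dir_add_pi, inner_neg_right, hx', hy']
      rw [abs_lt] at hx hy
      obtain ⟨hx1, hx2⟩ := hx
      obtain ⟨hy1, hy2⟩ := hy
      exact ⟨⟨fun h => by linarith [h.2.1],
        fun h => ⟨⟨by linarith, by linarith⟩, by linarith, by linarith⟩⟩,
        fun h => by linarith [h.2.1],
        fun h => ⟨⟨by linarith, by linarith⟩, by linarith, by linarith⟩⟩
    by_cases n4 : S.side - 2 * r < Y
    · refine Or.inr ⟨1, S.side - Y, fun z hzb => ?_⟩
      obtain ⟨hx, hy, hx', hy'⟩ := hz z hzb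
      rw [e1, hx', hy']
      rw [abs_lt] at hx hy
      obtain ⟨hx1, hx2⟩ := hx
      obtain ⟨hy1, hy2⟩ := hy
      exact ⟨⟨fun h => by linarith [h.2.2],
        fun h => ⟨⟨by linarith, by linarith⟩, by linarith, by linarith⟩⟩,
        fun h => by linarith [h.2.2],
        fun h => ⟨⟨by linarith, by linarith⟩, by linarith, by linarith⟩⟩
    · refine Or.inl fun z hzb => ?_
      obtain ⟨hx, hy, hx', hy'⟩ := hz z hzb
      rw [hx', hy']
      rw [abs_lt] at hx hy
      exact ⟨⟨by linarith, by linarith⟩, by linarith, by linarith⟩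

end Square

/-- Two disjoint sets that are locally half-planes and come close to `q` are proper half-planes
near `q`. -/
lemma exists_halfPlane {K U K' U' : Set Plane} {q : Plane} {r α α' s : ℝ}
    (H : LocallyHalfPlane K U q r α) (H' : LocallyHalfPlane K' U' q r α') (hs : s < r)
    (hd : Disjoint U U') (hK : (K ∩ Metric.ball q s).Nonempty)
    (hK' : (K' ∩ Metric.ball q s).Nonempty) :
    ∃ (j : ℤ) (h : ℝ), -s < h ∧ ∀ z ∈ Metric.ball q r,
      (z ∈ K ↔ inner ℝ (z - q) (dir (α + j * (Real.pi / 2))) ≤ h) ∧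
      (z ∈ U ↔ inner ℝ (z - q) (dir (α + j * (Real.pi / 2))) < h) := by
  have hsub : Metric.ball q s ⊆ Metric.ball q r := Metric.ball_subset_ball hs.le
  have low : ∀ (L : Set Plane) (t h : ℝ), (L ∩ Metric.ball q s).Nonempty →
      (∀ z ∈ Metric.ball q r, z ∈ L → inner ℝ (z - q) (dir t) ≤ h) → -s < h := by
    rintro L t h ⟨z, hzL, hz⟩ hh
    have h1 := hh z (hsub hz) hzL
    rw [Metric.mem_ball, dist_eq_norm] at hz
    have h2 := abs_inner_dir_le (z - q) t
    linarith [neg_abs_le (inner ℝ (z - q) (dir t))]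
  obtain ⟨z₀, hz₀K', hz₀⟩ := hK'
  have hs0 : 0 < s := Metric.pos_of_mem_ball hz₀
  rcases H with H | H | ⟨j, h, H⟩
  · obtain ⟨z, hzK, hz⟩ := hK
    exact absurd hzK (H z (hsub hz))
  · exfalso
    rcases H' with H' | H' | ⟨j, h, H'⟩
    · exact H' z₀ (hsub hz₀) hz₀K'
    · exact disjoint_left.1 hd (H z₀ (hsub hz₀)) (H' z₀ (hsub hz₀))
    · have hh := low K' _ h ⟨z₀, hz₀K', hz₀⟩ fun z hz => (H' z hz).1.1
      set n := dir (α' + j * (Real.pi / 2))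
      -- This point lies in `U'` because h > -s, and in `U` because `U` fills the ball.
      have hz : q + (-s) • n ∈ Metric.ball q r := by
        rw [Metric.mem_ball, dist_eq_norm, add_sub_cancel_left, norm_smul, norm_dir, norm_neg,
          Real.norm_eq_abs, abs_of_pos hs0]
        linarith
      refine disjoint_left.1 hd (H _ hz) ((H' _ hz).2.2 ?_)
      rw [add_sub_cancel_left, real_inner_smul_left, inner_dir_self]
      linarith
  · exact ⟨j, h, low K _ h hK fun z hz => (H z hz).1.1, H⟩

/-! ### Stars of a packing -/

namespace Packing

variable {S₀ : Square} (P : Packing S₀)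

/-- The interior of `P.star i`. -/
def openStar (i : Option (Fin P.count)) : Set Plane :=
  match i with
  | none => S₀.filledᶜ
  | some i => interior (P.unitSquare i).filled

lemma star_none : P.star none = (interior S₀.filled)ᶜ := by
  change S₀.boundary ∪ S₀.filledᶜ = _
  have h : interior S₀.filled ⊆ S₀.filled := interior_subset
  rw [Square.boundary, S₀.isClosed_filled.frontier_eq]
  ext p
  simp only [mem_union, mem_sdiff, mem_compl_iff]
  have := @h p
  tauto

lemma openStar_subset (i : Option (Fin P.count)) : P.openStar i ⊆ P.star i := by
  cases i with
  | none => rw [star_none]; exact compl_subset_compl.2 interior_subset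
  | some i => exact interior_subset

lemma disjoint_openStar {i k : Option (Fin P.count)} (hik : i ≠ k) :
    Disjoint (P.openStar i) (P.openStar k) := by
  have h : ∀ j, Disjoint (interior (P.unitSquare j).filled) S₀.filledᶜ := fun j =>
    disjoint_compl_right_iff_subset.2 (interior_subset.trans (P.subset_large j))
  cases i with
  | none =>
    cases k with
    | none => exact absurd rfl hik
    | some k => exact (h k).symm
  | some i =>
    cases k with
    | none => exact h i
    | some k => exact P.nonoverlapping i k fun e => hik (by rw [e])

/-- A unit square contains a disc of radius 1/2, so having one inside bounds the side of `S₀` from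
below; an empty packing would allow a tiny `S₀`. -/
lemma side_square_gt (i₀ : Fin P.count) (i : Option (Fin P.count)) :
    1 / 4 < (P.square i).side := by
  cases i with
  | some i => change _ < (P.unitSquare i).side; rw [P.side_eq_one]; norm_num
  | none =>
    change _ < S₀.side
    have key : ∀ σ : ℝ, |σ| < 1 / 2 →
        (P.unitSquare i₀).center + σ • dir S₀.angle ∈ S₀.filled := by
      intro σ hσ
      refine P.subset_large i₀ (interior_subset ((P.unitSquare i₀).ball_center_subset ?_))
      rw [Metric.mem_ball, dist_eq_norm, add_sub_cancel_left, norm_smul, norm_dir, mul_one,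
        P.side_eq_one]
      exact hσ
    have h1 := ((S₀.mem_filled_iff _).1 (key (1 / 4) (by norm_num [abs_of_pos]))).1.2
    have h2 := ((S₀.mem_filled_iff _).1 (key (-(1 / 4)) (by norm_num [abs_of_pos]))).1.1
    rw [add_sub_right_comm, inner_add_left, real_inner_smul_left, inner_dir_self] at h1 h2
    linarith

lemma locallyHalfPlane_star (i₀ : Fin P.count) (i : Option (Fin P.count)) (q : Plane) {r : ℝ}
    (hr : 0 < r) (hr' : r ≤ 1 / 16) (hq : ∀ x ∈ (P.square i).corners, 4 * r ≤ dist q x) :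
    LocallyHalfPlane (P.star i) (P.openStar i) q r (P.square i).angle := by
  have h := (P.square i).locallyHalfPlane q hr (by linarith [P.side_square_gt i₀ i]) hq
  cases i with
  | none => rw [star_none]; exact h.compl
  | some i => exact h

/-- Near every point of a star there is a ball of radius `1 / 2` contained in the star. -/
lemma exists_ball_subset_openStar (i : Option (Fin P.count)) {p : Plane} (hp : p ∈ P.star i) :
    ∃ x, dist x p ≤ 1 ∧ Metric.ball x (1 / 2) ⊆ P.openStar i := by
  cases i with
  | some i =>
    refine ⟨(P.unitSquare i).center, ?_, ?_⟩
    · rw [dist_comm, ← P.side_eq_one i]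
      exact (P.unitSquare i).dist_center_le hp
    · rw [← P.side_eq_one i]
      exact (P.unitSquare i).ball_center_subset
  | none =>
    rw [star_none, mem_compl_iff, Square.mem_interior_filled_iff] at hp
    -- If a side normal of `S₀` is at least as large at `p` as on all of `S₀`, the disc centred half
    -- a unit further out misses `S₀`.
    have key : ∀ σ t : ℝ, |σ| = 1 → (∀ z : Plane, z ∈ S₀.filled →
        σ * inner ℝ (z - S₀.corner) (dir t) ≤ σ * inner ℝ (p - S₀.corner) (dir t)) →
        ∃ x, dist x p ≤ 1 ∧ Metric.ball x (1 / 2) ⊆ P.openStar none := by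
      intro σ t hσ h
      have hσ2 : σ * σ = 1 := by rw [← abs_mul_abs_self, hσ, mul_one]
      refine ⟨p + (σ * (1 / 2)) • dir t, ?_, fun z hz hzS => ?_⟩
      · rw [dist_eq_norm, add_sub_cancel_left, norm_smul, norm_dir, Real.norm_eq_abs, abs_mul, hσ]
        norm_num
      · have h1 := h z hzS
        rw [Metric.mem_ball, dist_eq_norm] at hz
        have h2 := (abs_inner_dir_le _ t).trans_lt hz
        have e : z - (p + (σ * (1 / 2)) • dir t) =
          (z - S₀.corner) - (p - S₀.corner) - (σ * (1 / 2)) • dir t := by abel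
        rw [e, inner_sub_left, inner_sub_left, real_inner_smul_left, inner_dir_self] at h2
        have h3 : |σ * (inner ℝ (z - S₀.corner) (dir t) - inner ℝ (p - S₀.corner) (dir t) -
          σ * (1 / 2) * 1)| < 1 / 2 := by rw [abs_mul, hσ, one_mul]; exact h2
        rw [abs_lt] at h3
        nlinarith [h3.1]
    by_cases h1 : inner ℝ (p - S₀.corner) (dir S₀.angle) ≤ 0
    · exact key (-1) S₀.angle (by simp) fun z hz => by
        linarith [((S₀.mem_filled_iff z).1 hz).1.1]
    by_cases h2 : S₀.side ≤ inner ℝ (p - S₀.corner) (dir S₀.angle)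
    · exact key 1 S₀.angle (by simp) fun z hz => by
        linarith [((S₀.mem_filled_iff z).1 hz).1.2]
    by_cases h3 : inner ℝ (p - S₀.corner) (dir (S₀.angle + Real.pi / 2)) ≤ 0
    · exact key (-1) (S₀.angle + Real.pi / 2) (by simp) fun z hz => by
        linarith [((S₀.mem_filled_iff z).1 hz).2.1]
    by_cases h4 : S₀.side ≤ inner ℝ (p - S₀.corner) (dir (S₀.angle + Real.pi / 2))
    · exact key 1 (S₀.angle + Real.pi / 2) (by simp) fun z hz => by
        linarith [((S₀.mem_filled_iff z).1 hz).2.2]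
    · push Not at h1 h2 h3 h4
      exact absurd ⟨⟨h1, h2⟩, h3, h4⟩ hp

/-- At most 65 of the stars meet a ball of radius 2. -/
lemma card_le_of_star_inter_ball (q : Plane) (J : Finset (Option (Fin P.count)))
    (hJ : ∀ i ∈ J, (P.star i ∩ Metric.ball q 2).Nonempty) : J.card ≤ 65 := by
  classical
  have hsub : (J.filter fun i => i.isSome).card ≤ 64 := by
    set J' := J.filter fun i => i.isSome with hJ'
    have hx : ∀ i : Option (Fin P.count), ∃ x, i ∈ J' →
        Metric.ball x (1 / 2) ⊆ P.openStar i ∩ Metric.ball q 4 := by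
      intro i
      by_cases hi : i ∈ J'
      · obtain ⟨hiJ, his⟩ := Finset.mem_filter.1 hi
        obtain ⟨p, hp, hpq⟩ := hJ i hiJ
        obtain ⟨x, hxp, hxU⟩ := P.exists_ball_subset_openStar i hp
        refine ⟨x, fun _ => subset_inter hxU (Metric.ball_subset_ball' ?_)⟩
        rw [Metric.mem_ball] at hpq
        linarith [dist_triangle x p q]
      · exact ⟨q, fun h => absurd h hi⟩
    choose x hx using hx
    have hdis : (J' : Set (Option (Fin P.count))).PairwiseDisjoint
        fun i => Metric.ball (x i) (1 / 2) := by
      intro i hi k hk hik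
      exact (P.disjoint_openStar hik).mono ((hx i hi).trans inter_subset_left)
        ((hx k hk).trans inter_subset_left)
    -- Comparing areas gives the count 4² / (1/2)² = 64; the large square adds one more.
    have hle : volume (⋃ i ∈ J', Metric.ball (x i) (1 / 2)) ≤ volume (Metric.ball q 4) :=
      measure_mono (iUnion₂_subset fun i hi => (hx i hi).trans inter_subset_right)
    rw [measure_biUnion_finset hdis fun i _ => measurableSet_ball] at hle
    simp only [EuclideanSpace.volume_ball_fin_two, Finset.sum_const, nsmul_eq_mul] at hle
    have hpi := Real.pi_pos
    have h := ENNReal.toReal_mono (by finiteness) hle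
    simp [ENNReal.toReal_mul, ENNReal.toReal_ofReal hpi.le] at h
    have h2 : (J'.card : ℝ) ≤ 64 := by nlinarith
    exact_mod_cast h2
  have h1 : J ⊆ insert none (J.filter fun i => i.isSome) := by
    intro i hi
    cases i with
    | none => exact Finset.mem_insert_self _ _
    | some i => exact Finset.mem_insert_of_mem (Finset.mem_filter.2 ⟨hi, rfl⟩)
  exact (Finset.card_le_card h1).trans ((Finset.card_insert_le _ _).trans (by lia))

end Packing

/-! ### Geometry of disjoint half-planes -/

/-- The half-planes `⟪w, dir t⟫ < h` and `⟪w, dir t'⟫ < h'` are disjoint inside the ball of radius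
`r` around the origin. -/
def DisjointHalfPlanes (r t h t' h' : ℝ) : Prop :=
  ∀ w : Plane, ‖w‖ < r → inner ℝ w (dir t) < h → h' ≤ inner ℝ w (dir t')

lemma disjointHalfPlanes_of_disjoint {U U' : Set Plane} {q : Plane} {r t h t' h' : ℝ}
    (H : ∀ z ∈ Metric.ball q r, z ∈ U ↔ inner ℝ (z - q) (dir t) < h)
    (H' : ∀ z ∈ Metric.ball q r, z ∈ U' ↔ inner ℝ (z - q) (dir t') < h')
    (hd : Disjoint U U') : DisjointHalfPlanes r t h t' h' := by
  intro w hw h1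
  by_contra! h2
  have hz : q + w ∈ Metric.ball q r := by
    rwa [Metric.mem_ball, dist_eq_norm, add_sub_cancel_left]
  refine disjoint_left.1 hd ((H _ hz).2 ?_) ((H' _ hz).2 ?_) <;> rwa [add_sub_cancel_left]

namespace DisjointHalfPlanes

variable {r ρ t h t' h' : ℝ}

/-- The normals of disjoint half-planes which come close to the center are nearly opposite. -/
lemma mul_one_add_inner_le (H : DisjointHalfPlanes r t h t' h') (hr : 0 < r) (hh : -ρ < h)
    (hh' : -ρ < h') : r / 4 * (1 + inner ℝ (dir t) (dir t')) ≤ ρ := by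
  by_contra! hcon
  -- If the bound failed, this point would lie in both half-planes.
  have hw : ‖(-(r / 4)) • (dir t + dir t')‖ < r := by
    rw [norm_smul, norm_neg, Real.norm_eq_abs, abs_of_pos (by positivity)]
    have := norm_add_le (dir t) (dir t')
    rw [norm_dir, norm_dir] at this
    nlinarith
  have h1 := H _ hw (by
    rw [real_inner_smul_left, inner_add_left, inner_dir_self, real_inner_comm]
    linarith)
  rw [real_inner_smul_left, inner_add_left, inner_dir_self] at h1
  linarith

/-- If two half-planes are disjoint, one coming very close to the center and the other within `3 / 5`
of the radius, then the angle between their normals exceeds a right angle. -/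
lemma inner_lt (H : DisjointHalfPlanes r t h t' h') (hρ : 0 < ρ) (hr : 400 * ρ ≤ r)
    (hh : -ρ < h) (hh' : -(3 / 5 * r) < h') : inner ℝ (dir t) (dir t') < -(3 / 40) := by
  by_contra! hcon
  set σ := inner ℝ (dir t) (dir t') with hσ
  have hσ' : inner ℝ (dir t') (dir t) = σ := real_inner_comm _ _
  -- With σ ≥ -3/40 this point has depth at least 0.1475r along `t` and 0.685r along `t'`, beyond ρ
  -- and 3r/5.
  have hw : ‖(-(7 / 10 * r)) • dir t' + (-(r / 5)) • dir t‖ < r := by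
    refine (norm_add_le _ _).trans_lt ?_
    rw [norm_smul, norm_smul, norm_dir, norm_dir, norm_neg, norm_neg, Real.norm_eq_abs,
      Real.norm_eq_abs, abs_of_pos (by linarith), abs_of_pos (by linarith)]
    linarith
  have hb : r * -(3 / 40) ≤ r * σ := mul_le_mul_of_nonneg_left hcon (by linarith)
  have h1 := H _ hw (by
    rw [inner_add_left, real_inner_smul_left, real_inner_smul_left, inner_dir_self, hσ']
    linarith)
  rw [inner_add_left, real_inner_smul_left, real_inner_smul_left, inner_dir_self, ← hσ] at h1
  linarith

/-- Two nearly touching half-planes leave no room for a third one. -/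
lemma not_third {t₃ h₃ : ℝ} (H : DisjointHalfPlanes r t h t' h')
    (H₁ : DisjointHalfPlanes r t h t₃ h₃) (H₂ : DisjointHalfPlanes r t' h' t₃ h₃)
    (hρ : 0 < ρ) (hr : 400 * ρ ≤ r) (hh : -ρ < h) (hh' : -ρ < h') (hh₃ : -(3 / 5 * r) < h₃) :
    False := by
  have a := H₁.inner_lt hρ hr hh hh₃
  have b := H₂.inner_lt hρ hr hh' hh₃
  have c := H.mul_one_add_inner_le (by linarith) hh hh'
  have hs : 1 + inner ℝ (dir t) (dir t') ≤ 1 / 100 := by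
    by_contra! hcon
    nlinarith
  -- The third normal has inner product below -3/20 with this sum, whose norm is at most √(1/50) <
  -- 3/20.
  have hn : ‖dir t + dir t'‖ ^ 2 ≤ 1 / 50 := by
    rw [norm_add_sq_real, norm_dir, norm_dir]
    linarith
  have hi := abs_inner_dir_le (dir t + dir t') t₃
  rw [inner_add_left] at hi
  have := neg_abs_le (inner ℝ (dir t) (dir t₃) + inner ℝ (dir t') (dir t₃))
  nlinarith [norm_nonneg (dir t + dir t')]

/-- Two nearly touching half-planes leave a gap between them which contains a rectangle. -/
lemma exists_gap (H : DisjointHalfPlanes r t h t' h') (hρ : 0 < ρ) (hr : 400 * ρ ≤ r)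
    (hh : -ρ < h) (hh' : -ρ < h') (q : Plane) :
    ∃ R : Set Plane, IsOpen R ∧ R ⊆ Metric.ball q (r / 4) ∧
      (∀ z ∈ R, h < inner ℝ (z - q) (dir t) ∧ h' < inner ℝ (z - q) (dir t')) ∧
      volume R = ENNReal.ofReal (r ^ 2 / 128 * |Real.sin (t - t')|) := by
  have hr0 : 0 < r := by linarith
  set C := -inner ℝ (dir t) (dir t') with hC
  set D := inner ℝ (dir (t + Real.pi / 2)) (dir t') with hD
  have hDsin : |D| = |Real.sin (t - t')| := by
    rw [hD, inner_dir_dir, add_sub_right_comm, Real.cos_add_pi_div_two, abs_neg]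
  have hC1 : C ≤ 1 := by
    rw [hC, inner_dir_dir]; linarith [Real.neg_one_le_cos (t - t')]
  have hC2 : 99 / 100 ≤ C := by
    have := H.mul_one_add_inner_le hr0 hh hh'
    by_contra! hcon
    nlinarith
  -- In the frame at `t`, with y along the normal, the second normal is (x, y) = (D, -C).
  have key : ∀ x y : ℝ, |x| + |y| < r → y < h → h' ≤ x * D - y * C := by
    intro x y hxy hy
    have hw : ‖y • dir t + x • dir (t + Real.pi / 2)‖ < r := by
      refine (norm_add_le _ _).trans_lt ?_
      rw [norm_smul, norm_smul, norm_dir, norm_dir, Real.norm_eq_abs, Real.norm_eq_abs]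
      linarith
    have h1 := H _ hw (by
      rw [inner_add_left, real_inner_smul_left, real_inner_smul_left, inner_dir_self,
        inner_perp_dir]
      linarith)
    rw [inner_add_left, real_inner_smul_left, real_inner_smul_left] at h1
    linarith
  have hup : h ≤ 2 * ρ := by
    by_contra! hcon
    have h1 := key 0 (2 * ρ) (by rw [abs_zero, abs_of_pos (by linarith)]; linarith) hcon
    nlinarith
  have key2 : ∀ x : ℝ, |x| ≤ r / 2 → h' ≤ x * D - h * C := by
    intro x hx
    by_contra! hcon
    set ε := min (r / 4) ((h' - (x * D - h * C)) / 2) with hε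
    have hε0 : 0 < ε := lt_min (by linarith) (by linarith)
    have hε1 : ε ≤ r / 4 := min_le_left _ _
    have hε2 : ε ≤ (h' - (x * D - h * C)) / 2 := min_le_right _ _
    have h1 := key x (h - ε) (by
      have : |h - ε| ≤ 2 * ρ + r / 4 := abs_le.2 ⟨by linarith, by linarith⟩
      linarith) (by linarith)
    nlinarith
  -- Taking x = ±r/2 with the sign opposite to D shows that the tilt leaves slack r|D|/2; the
  -- rectangle below uses at most r|D|/8 of it.
  have hbound : h' ≤ -(r / 2 * |D|) - h * C := by
    have h1 := key2 (r / 2) (by rw [abs_of_pos (by linarith)])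
    have h2 := key2 (-(r / 2)) (by rw [abs_neg, abs_of_pos (by linarith)])
    rcases abs_cases D with ⟨e, _⟩ | ⟨e, _⟩ <;> rw [e] <;> linarith
  have hD1 : |D| ≤ 1 := by rw [hDsin]; exact Real.abs_sin_le_one _
  refine ⟨{z | inner ℝ (z - q) (dir t) ∈ Ioo h (h + r / 16 * |D|) ∧
    inner ℝ (z - q) (dir (t + Real.pi / 2)) ∈ Ioo (-(r / 16)) (r / 16)},
    isOpen_rectangle _ _ _ _ _ _, ?_, ?_, ?_⟩
  · rintro z ⟨⟨h1, h2⟩, h3, h4⟩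
    have h5 : ‖z - q‖ ≤ |inner ℝ (z - q) (dir t)| +
        |inner ℝ (z - q) (dir (t + Real.pi / 2))| := by
      conv_lhs => rw [eq_frame_expansion (z - q) t]
      refine (norm_add_le _ _).trans ?_
      rw [norm_smul, norm_smul, norm_dir, norm_dir, Real.norm_eq_abs, Real.norm_eq_abs, mul_one,
        mul_one]
    have h6 : |inner ℝ (z - q) (dir t)| < 2 * ρ + r / 16 :=
      abs_lt.2 ⟨by linarith, by nlinarith⟩
    have h7 : |inner ℝ (z - q) (dir (t + Real.pi / 2))| < r / 16 := abs_lt.2 ⟨h3, h4⟩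
    rw [Metric.mem_ball, dist_eq_norm]
    linarith
  · rintro z ⟨⟨h1, h2⟩, h3, h4⟩
    refine ⟨h1, ?_⟩
    set y := inner ℝ (z - q) (dir t) with hy
    set x := inner ℝ (z - q) (dir (t + Real.pi / 2)) with hx
    have e : inner ℝ (z - q) (dir t') = x * D - y * C := by
      conv_lhs => rw [eq_frame_expansion (z - q) t]
      rw [inner_add_left, real_inner_smul_left, real_inner_smul_left]
      ring
    have hD0 : 0 < |D| := by
      by_contra! hcon
      nlinarith
    have hxD : -(r / 16 * |D|) ≤ x * D := by
      have h5 : |x| ≤ r / 16 := abs_le.2 ⟨h3.le, h4.le⟩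
      have h6 := neg_abs_le (x * D)
      rw [abs_mul] at h6
      nlinarith
    have hyC : y * C ≤ h * C + r / 16 * |D| := by nlinarith
    have := mul_pos hr0 hD0
    rw [e]
    linarith
  · rw [volume_rectangle, ← ENNReal.ofReal_mul (by
      have := abs_nonneg D; rw [add_sub_cancel_left]; positivity), hDsin]
    congr 1
    ring

end DisjointHalfPlanes

/-! ### Stars facing each other -/

namespace Packing

variable {S₀ : Square} (P : Packing S₀)

/-- Near `q`, all stars of the packing are half-planes, and the stars `i` and `k` come close
to `q`. -/
structure FacingAt (q : Plane) (ρ r : ℝ) (i k : Option (Fin P.count)) : Prop where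
  locallyHalfPlane : ∀ m, LocallyHalfPlane (P.star m) (P.openStar m) q r (P.square m).angle
  near_left : (P.star i ∩ Metric.ball q ρ).Nonempty
  near_right : (P.star k ∩ Metric.ball q ρ).Nonempty

namespace FacingAt

variable {P} {q : Plane} {ρ r : ℝ} {i k : Option (Fin P.count)}

lemma exists_disjointHalfPlanes (H : P.FacingAt q ρ r i k) (hik : i ≠ k) (hρr : ρ < r) :
    ∃ (j j' : ℤ) (h h' : ℝ), -ρ < h ∧ -ρ < h' ∧
      (∀ z ∈ Metric.ball q r,
        (z ∈ P.star i ↔ inner ℝ (z - q) (dir ((P.square i).angle + j * (Real.pi / 2))) ≤ h) ∧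
        (z ∈ P.openStar i ↔
          inner ℝ (z - q) (dir ((P.square i).angle + j * (Real.pi / 2))) < h)) ∧
      (∀ z ∈ Metric.ball q r,
        (z ∈ P.star k ↔ inner ℝ (z - q) (dir ((P.square k).angle + j' * (Real.pi / 2))) ≤ h') ∧
        (z ∈ P.openStar k ↔
          inner ℝ (z - q) (dir ((P.square k).angle + j' * (Real.pi / 2))) < h')) ∧
      DisjointHalfPlanes r ((P.square i).angle + j * (Real.pi / 2)) h
        ((P.square k).angle + j' * (Real.pi / 2)) h' := by
  have hd := P.disjoint_openStar hik
  obtain ⟨j, h, hh, h1⟩ := exists_halfPlane (H.locallyHalfPlane i) (H.locallyHalfPlane k) hρr hd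
    H.near_left H.near_right
  obtain ⟨j', h', hh', h2⟩ := exists_halfPlane (H.locallyHalfPlane k) (H.locallyHalfPlane i) hρr
    hd.symm H.near_right H.near_left
  exact ⟨j, j', h, h', hh, hh', h1, h2,
    disjointHalfPlanes_of_disjoint (fun z hz => (h1 z hz).2) (fun z hz => (h2 z hz).2) hd⟩

/-- No other star comes near a point where two stars face each other. -/
lemma eq_or_eq (H : P.FacingAt q ρ r i k) (hik : i ≠ k) (hρ : 0 < ρ) (hr : 400 * ρ ≤ r)
    {m : Option (Fin P.count)} (hm : (P.star m ∩ Metric.ball q (3 / 5 * r)).Nonempty) :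
    m = i ∨ m = k := by
  by_contra! hcon
  obtain ⟨j, j', h, h', hh, hh', h1, h2, h3⟩ := H.exists_disjointHalfPlanes hik (by linarith)
  have hsub : (P.star i ∩ Metric.ball q (3 / 5 * r)).Nonempty :=
    H.near_left.mono (inter_subset_inter_right _ (Metric.ball_subset_ball (by linarith)))
  obtain ⟨j₃, h₃, hh₃, h4⟩ := exists_halfPlane (H.locallyHalfPlane m) (H.locallyHalfPlane i)
    (by linarith) (P.disjoint_openStar hcon.1) hm hsub
  exact h3.not_third
    (disjointHalfPlanes_of_disjoint (fun z hz => (h1 z hz).2) (fun z hz => (h4 z hz).2)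
      (P.disjoint_openStar hcon.1.symm))
    (disjointHalfPlanes_of_disjoint (fun z hz => (h2 z hz).2) (fun z hz => (h4 z hz).2)
      (P.disjoint_openStar hcon.2.symm)) hρ hr hh hh' hh₃

/-- Between two stars facing each other there is wasted area at least proportional to the angle
between them. -/
lemma exists_waste (H : P.FacingAt q ρ r i k) (hik : i ≠ k) (hρ : 0 < ρ) (hr : 400 * ρ ≤ r)
    (S : Square) :
    ∃ R : Set Plane, IsOpen R ∧ R ⊆ Metric.ball q (r / 4) ∧ (∀ m, Disjoint R (P.star m)) ∧
      ENNReal.ofReal (r ^ 2 / 256 * (S.theta (P.square k) - S.theta (P.square i))) ≤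
        volume R := by
  obtain ⟨j, j', h, h', hh, hh', h1, h2, h3⟩ := H.exists_disjointHalfPlanes hik (by linarith)
  obtain ⟨R, hR, hRb, hRd, hRv⟩ := h3.exists_gap hρ hr hh hh' q
  have hRr : R ⊆ Metric.ball q r := hRb.trans (Metric.ball_subset_ball (by linarith))
  refine ⟨R, hR, hRb, fun m => disjoint_left.2 fun z hz hzm => ?_, ?_⟩
  · rcases H.eq_or_eq hik hρ hr
      ⟨z, hzm, Metric.ball_subset_ball (by linarith) (hRb hz)⟩ with rfl | rfl
    · linarith [((h1 z (hRr hz)).1).1 hzm, (hRd z hz).1]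
    · linarith [((h2 z (hRr hz)).1).1 hzm, (hRd z hz).2]
  · rw [hRv]
    refine ENNReal.ofReal_le_ofReal ?_
    have h5 := S.theta_le_theta_add_sin (P.square i) (P.square k) j j'
    set s := |Real.sin ((P.square i).angle + j * (Real.pi / 2) -
      ((P.square k).angle + j' * (Real.pi / 2)))|
    have h6 : Real.pi / 2 * s ≤ 2 * s :=
      mul_le_mul_of_nonneg_right (by linarith [Real.pi_le_four]) (abs_nonneg _)
    have h7 := sq_nonneg r
    nlinarith

end FacingAt

end Packing

/-! ### Avoiding corners and crossing between classes -/

/-- An interval of length 1 is not covered by few short intervals. -/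
lemma exists_forall_le_abs_sub (X : Finset ℝ) (hX : X.card ≤ 260) :
    ∃ t : ℝ, |t| < 1 / 2 ∧ ∀ x ∈ X, 1 / 600 ≤ |x - t| := by
  by_contra! hcon
  have hsub : Ioo (-(1 / 2) : ℝ) (1 / 2) ⊆ ⋃ x ∈ X, Metric.ball x (1 / 600) := by
    intro t ht
    obtain ⟨x, hx, hxt⟩ := hcon t (abs_lt.2 ht)
    refine mem_iUnion₂.2 ⟨x, hx, ?_⟩
    rwa [Metric.mem_ball, dist_comm, Real.dist_eq]
  -- The total length is at most 260 · (1/300) < 1.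
  have h := (measure_mono (μ := volume) hsub).trans (measure_biUnion_finset_le X _)
  simp only [Real.volume_Ioo, Real.volume_ball, Finset.sum_const, nsmul_eq_mul] at h
  rw [← ENNReal.ofReal_natCast, ← ENNReal.ofReal_mul (by positivity),
    ENNReal.ofReal_le_ofReal_iff (by positivity)] at h
  have h2 : (X.card : ℝ) ≤ 260 := by exact_mod_cast hX
  linarith

/-- If a connected set is covered by neighborhoods of sets of two classes, it has a point that is
close to sets of both classes. -/
lemma IsPreconnected.exists_near_both {ι : Type*} {K : ι → Set Plane} {G : Set Plane} {ρ : ℝ}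
    (hG : IsPreconnected G) (hcov : ∀ q ∈ G, ∃ m, (K m ∩ Metric.ball q ρ).Nonempty)
    (A : ι → Prop) {a b : ι} (ha : A a) (hb : ¬ A b)
    (hKa : ∃ x ∈ G, (K a ∩ Metric.ball x ρ).Nonempty)
    (hKb : ∃ y ∈ G, (K b ∩ Metric.ball y ρ).Nonempty) :
    ∃ q ∈ G, ∃ i k, A i ∧ ¬ A k ∧ (K i ∩ Metric.ball q ρ).Nonempty ∧
      (K k ∩ Metric.ball q ρ).Nonempty := by
  have near : ∀ q m, q ∈ Metric.thickening ρ (K m) ↔ (K m ∩ Metric.ball q ρ).Nonempty := by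
    intro q m
    rw [Metric.mem_thickening_iff]
    simp only [Set.Nonempty, mem_inter_iff, Metric.mem_ball, dist_comm]
  obtain ⟨q, hq, hu, hv⟩ := hG (⋃ m ∈ {m | A m}, Metric.thickening ρ (K m))
    (⋃ m ∈ {m | ¬ A m}, Metric.thickening ρ (K m))
    (isOpen_biUnion fun _ _ => Metric.isOpen_thickening)
    (isOpen_biUnion fun _ _ => Metric.isOpen_thickening)
    (fun q hq => by
      obtain ⟨m, hm⟩ := hcov q hq
      by_cases hA : A m
      · exact Or.inl (mem_iUnion₂.2 ⟨m, hA, (near q m).2 hm⟩)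
      · exact Or.inr (mem_iUnion₂.2 ⟨m, hA, (near q m).2 hm⟩))
    (by
      obtain ⟨x, hx, hm⟩ := hKa
      exact ⟨x, hx, mem_iUnion₂.2 ⟨a, ha, (near x a).2 hm⟩⟩)
    (by
      obtain ⟨x, hx, hm⟩ := hKb
      exact ⟨x, hx, mem_iUnion₂.2 ⟨b, hb, (near x b).2 hm⟩⟩)
  obtain ⟨i, hi, hqi⟩ := mem_iUnion₂.1 hu
  obtain ⟨k, hk, hqk⟩ := mem_iUnion₂.1 hv
  exact ⟨q, hq, i, k, hi, hk, (near q i).1 hqi, (near q k).1 hqk⟩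

/-! ### Finding gaps along the path and adding them up -/

namespace Packing

variable {S₀ : Square} (P : Packing S₀)

lemma waste_nonneg (A : Set Plane) : 0 ≤ P.waste A := measureReal_nonneg

lemma volume_le_ofReal_waste {U A : Set Plane} (hUA : U ⊆ A)
    (hU : ∀ m, Disjoint U (P.star m)) : volume U ≤ ENNReal.ofReal (P.waste A) := by
  -- `volume.real` is 0 on sets of infinite measure, so finiteness matters here.
  have hfin : volume (A \ ⋃ i, P.star i) ≠ ⊤ := by
    refine ((measure_mono ?_).trans_lt S₀.isBounded_filled.measure_lt_top).ne
    intro p hp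
    by_contra hpS
    exact hp.2 (mem_iUnion.2 ⟨none, P.openStar_subset none hpS⟩)
  rw [waste, Measure.real, ENNReal.ofReal_toReal hfin]
  exact measure_mono (subset_sdiff.2 ⟨hUA, disjoint_iUnion_right.2 hU⟩)

/-- A ball which meets no star is wasted. -/
lemma exists_star_inter_ball {A : Set Plane} {q : Plane} {ρ : ℝ} (hρ : 0 ≤ ρ)
    (hA : Metric.ball q ρ ⊆ A) (hW : P.waste A < ρ ^ 2 * Real.pi) :
    ∃ m, (P.star m ∩ Metric.ball q ρ).Nonempty := by
  by_contra! hcon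
  have h := P.volume_le_ofReal_waste hA fun m => (disjoint_iff_inter_eq_empty.2 (hcon m)).symm
  have hpi := Real.pi_pos
  rw [EuclideanSpace.volume_ball_fin_two, ← ENNReal.ofReal_pow hρ,
    ← ENNReal.ofReal_mul (by positivity), ENNReal.ofReal_le_ofReal_iff (P.waste_nonneg _)] at h
  exact absurd hW (not_lt.2 h)

/-- If every point close to a connected set `Γ` is close to a star, and `Γ` meets stars of two
classes, then near `Γ` two stars of different classes face each other. -/
lemma exists_facingAt (i₀ : Fin P.count) {Γ : Set Plane} (hΓ : IsPreconnected Γ) {ρ : ℝ}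
    (hρ : 0 < ρ) (hρ' : ρ ≤ 1 / 100)
    (hcov : ∀ q ∈ Metric.thickening 2 Γ, ∃ m, (P.star m ∩ Metric.ball q ρ).Nonempty)
    (A : Option (Fin P.count) → Prop) {a b : Option (Fin P.count)} (ha : A a) (hb : ¬ A b)
    (hΓa : (Γ ∩ P.star a).Nonempty) (hΓb : (Γ ∩ P.star b).Nonempty) :
    ∃ q ∈ Metric.thickening 2 Γ, ∃ i k, A i ∧ ¬ A k ∧ P.FacingAt q ρ (1 / 2400) i k := by
  classical
  obtain ⟨q₀, hq₀, i, k, hi, hk, ⟨p₁, hp₁, hp₁q⟩, ⟨p₂, hp₂, hp₂q⟩⟩ :=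
    hΓ.exists_near_both
    (fun q hq => hcov q (Metric.self_subset_thickening (by norm_num) Γ hq)) A ha hb
    (hΓa.imp fun x hx => ⟨hx.1, x, hx.2, Metric.mem_ball_self hρ⟩)
    (hΓb.imp fun x hx => ⟨hx.1, x, hx.2, Metric.mem_ball_self hρ⟩)
  obtain ⟨x₁, hx₁, hb₁⟩ := P.exists_ball_subset_openStar i hp₁
  obtain ⟨x₂, hx₂, hb₂⟩ := P.exists_ball_subset_openStar k hp₂
  rw [Metric.mem_ball] at hp₁q hp₂q
  have hd₁ : dist x₁ q₀ ≤ 1 + 1 / 100 := by linarith [dist_triangle x₁ p₁ q₀]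
  have hd₂ : dist x₂ q₀ ≤ 1 + 1 / 100 := by linarith [dist_triangle x₂ p₂ q₀]
  -- Shifting the segment of centres by t along its normal ν, with |t| < 1/2, keeps its ends in the
  -- two discs and its ν-coordinate constant, so only the ν-coordinates of the 65 · 4 corners have
  -- to be avoided.
  obtain ⟨φ, hφ⟩ := exists_eq_norm_smul_dir (x₂ - x₁)
  set ν := dir (φ + Real.pi / 2) with hν
  set J := Finset.univ.filter fun m => (P.star m ∩ Metric.ball q₀ 2).Nonempty with hJ
  have hJc : J.card ≤ 65 :=
    P.card_le_of_star_inter_ball q₀ J fun m hm => (Finset.mem_filter.1 hm).2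
  obtain ⟨t, ht, htX⟩ := exists_forall_le_abs_sub
    ((J.biUnion fun m => (P.square m).corners).image fun x => inner ℝ (x - x₁) ν) (by
      refine Finset.card_image_le.trans ?_
      refine (Finset.card_biUnion_le_card_mul J _ 4 fun m _ => (P.square m).card_corners_le).trans ?_
      lia)
  have hnear : ∀ x : Plane, dist (x + t • ν) x < 1 / 2 := by
    intro x
    rwa [dist_eq_norm, add_sub_cancel_left, norm_smul, norm_dir, mul_one]
  have hseg : segment ℝ (x₁ + t • ν) (x₂ + t • ν) ⊆ Metric.closedBall q₀ (3 / 2 + 1 / 100) := by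
    refine (convex_closedBall q₀ _).segment_subset ?_ ?_ <;> rw [Metric.mem_closedBall]
    · linarith [dist_triangle (x₁ + t • ν) x₁ q₀, hnear x₁]
    · linarith [dist_triangle (x₂ + t • ν) x₂ q₀, hnear x₂]
  have hthick : segment ℝ (x₁ + t • ν) (x₂ + t • ν) ⊆ Metric.thickening 2 Γ := by
    intro q hq
    have := Metric.mem_closedBall.1 (hseg hq)
    exact Metric.mem_thickening_iff.2 ⟨q₀, hq₀, by linarith⟩
  have hline : ∀ q ∈ segment ℝ (x₁ + t • ν) (x₂ + t • ν), inner ℝ (q - x₁) ν = t := by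
    intro q hq
    rw [segment_eq_image'] at hq
    obtain ⟨s, -, rfl⟩ := hq
    have e : x₁ + t • ν + s • (x₂ + t • ν - (x₁ + t • ν)) - x₁ = t • ν + s • (x₂ - x₁) := by
      rw [add_sub_add_right_eq_sub]; abel
    simp only [e]
    rw [hφ, inner_add_left, real_inner_smul_left, real_inner_smul_left, real_inner_smul_left, hν,
      inner_dir_self, inner_dir_perp]
    ring
  obtain ⟨q, hq, i', k', hi', hk', hqi, hqk⟩ :=
    (convex_segment (x₁ + t • ν) (x₂ + t • ν)).isPreconnected.exists_near_both
    (fun q hq => hcov q (hthick hq)) A hi hk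
    ⟨_, left_mem_segment ℝ _ _, x₁ + t • ν, P.openStar_subset i (hb₁ (hnear x₁)),
      Metric.mem_ball_self hρ⟩
    ⟨_, right_mem_segment ℝ _ _, x₂ + t • ν, P.openStar_subset k (hb₂ (hnear x₂)),
      Metric.mem_ball_self hρ⟩
  refine ⟨q, hthick hq, i', k', hi', hk', fun m => ?_, hqi, hqk⟩
  by_cases hm : m ∈ J
  · refine P.locallyHalfPlane_star i₀ m q (by norm_num) (by norm_num) fun x hx => ?_
    have h1 := htX _ (Finset.mem_image_of_mem _ (Finset.mem_biUnion.2 ⟨m, hm, hx⟩))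
    rw [← hline q hq, ← inner_sub_left, sub_sub_sub_cancel_right] at h1
    have h2 := abs_inner_dir_le (x - q) (φ + Real.pi / 2)
    rw [dist_comm, dist_eq_norm]
    linarith
  -- The segment stays within 1.51 of `q₀`, so stars outside `J` miss the small ball.
  · refine Or.inl fun z hz hzm => hm (Finset.mem_filter.2 ⟨Finset.mem_univ m, z, hzm, ?_⟩)
    have h1 := Metric.mem_closedBall.1 (hseg hq)
    rw [Metric.mem_ball] at hz ⊢
    linarith [dist_triangle z q q₀]

/-- The gaps between facing stars along a connected set add up to at least a multiple of the
angle. -/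
lemma mul_theta_le_waste (i₀ : Fin P.count) {Γ : Set Plane} (hΓ : IsPreconnected Γ) {ρ : ℝ}
    (hρ : 0 < ρ) (hρ' : ρ ≤ 1 / 10 ^ 6)
    (hcov : ∀ q ∈ Metric.thickening 2 Γ, ∃ m, (P.star m ∩ Metric.ball q ρ).Nonempty)
    {a b : Option (Fin P.count)}
    (hΓa : (Γ ∩ P.star a).Nonempty) (hΓb : (Γ ∩ P.star b).Nonempty) :
    (1 / 2400) ^ 2 / 256 * (P.square a).theta (P.square b) ≤
      P.waste (Metric.thickening 5 Γ) := by
  classical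
  set f : Option (Fin P.count) → ℝ := fun m => (P.square a).theta (P.square m) with hf
  set F : Finset (Option (Fin P.count) × Option (Fin P.count)) := Finset.univ.filter fun p =>
    f p.1 < f p.2 ∧ ∃ q ∈ Metric.thickening 2 Γ, P.FacingAt q ρ (1 / 2400) p.1 p.2 with hF
  have hne : ∀ p ∈ F, p.1 ≠ p.2 := fun p hp h => by
    have := (Finset.mem_filter.1 hp).2.1
    rw [h] at this
    exact lt_irrefl _ this
  have hcover : Ico 0 (f b) ⊆ ⋃ p ∈ F, Ico (f p.1) (f p.2) := by
    intro l hl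
    obtain ⟨q, hq, i, k, hi, hk, hqik⟩ := P.exists_facingAt i₀ hΓ hρ (by linarith) hcov
      (fun m => f m ≤ l) (a := a) (b := b) (by rw [hf]; simpa [Square.theta_self] using hl.1)
      (not_le.2 hl.2) hΓa hΓb
    have hk' := not_le.1 hk
    exact mem_iUnion₂.2 ⟨(i, k),
      Finset.mem_filter.2 ⟨Finset.mem_univ _, hi.trans_lt hk', q, hq, hqik⟩, hi, hk'⟩
  have hgap : ∀ p : Option (Fin P.count) × Option (Fin P.count), ∃ (q : Plane) (R : Set Plane),
      p ∈ F → q ∈ Metric.thickening 2 Γ ∧ P.FacingAt q ρ (1 / 2400) p.1 p.2 ∧ IsOpen R ∧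
        R ⊆ Metric.ball q (1 / 2400 / 4) ∧ (∀ m, Disjoint R (P.star m)) ∧
        ENNReal.ofReal ((1 / 2400) ^ 2 / 256 * (f p.2 - f p.1)) ≤ volume R := by
    intro p
    by_cases hp : p ∈ F
    · obtain ⟨q, hq, hqp⟩ := (Finset.mem_filter.1 hp).2.2
      obtain ⟨R, h⟩ := hqp.exists_waste (hne p hp) hρ (by linarith) (P.square a)
      exact ⟨q, R, fun _ => ⟨hq, hqp, h⟩⟩
    · exact ⟨0, ∅, fun h => absurd h hp⟩
  choose q R hR using hgap
  have hdisj : (F : Set (Option (Fin P.count) × Option (Fin P.count))).PairwiseDisjoint R := by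
    intro p hp p' hp' hpp'
    refine disjoint_left.2 fun z hz hz' => hpp' ?_
    obtain ⟨-, h1, -, h2, -⟩ := hR p hp
    obtain ⟨-, h3, -, h4, -⟩ := hR p' hp'
    have hzq := Metric.mem_ball.1 (h2 hz)
    have hzq' := Metric.mem_ball.1 (h4 hz')
    -- Overlapping gaps have centres within r/2, where r = 1/2400, and ρ ≤ r/10. So both stars of
    -- `p'` belong to `p`, and the order of the f-values excludes the swapped pair.
    have hsub : Metric.ball (q p') ρ ⊆ Metric.ball (q p) (3 / 5 * (1 / 2400)) := by
      refine Metric.ball_subset_ball' ?_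
      have := dist_triangle_left (q p') (q p) z
      linarith
    have e1 := h1.eq_or_eq (hne p hp) hρ (by linarith)
      (h3.near_left.mono (inter_subset_inter_right _ hsub))
    have e2 := h1.eq_or_eq (hne p hp) hρ (by linarith)
      (h3.near_right.mono (inter_subset_inter_right _ hsub))
    have l := (Finset.mem_filter.1 hp).2.1
    have l' := (Finset.mem_filter.1 hp').2.1
    have n' := hne p' hp'
    rcases e1 with e1 | e1 <;> rcases e2 with e2 | e2
    · exact absurd (e1.trans e2.symm) n'
    · exact Prod.ext e1.symm e2.symm
    · rw [e1, e2] at l'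
      exact absurd l' l.not_gt
    · exact absurd (e1.trans e2.symm) n'
  have h1 : ENNReal.ofReal (f b) ≤ ∑ p ∈ F, ENNReal.ofReal (f p.2 - f p.1) := by
    have h := (measure_mono (μ := volume) hcover).trans (measure_biUnion_finset_le F _)
    simpa only [Real.volume_Ico, sub_zero] using h
  have h2 : volume (⋃ p ∈ F, R p) ≤ ENNReal.ofReal (P.waste (Metric.thickening 5 Γ)) := by
    refine P.volume_le_ofReal_waste (iUnion₂_subset fun p hp z hz => ?_) fun m =>
      disjoint_iUnion₂_left.2 fun p hp => (hR p hp).2.2.2.2.1 m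
    obtain ⟨x, hx, hqx⟩ := Metric.mem_thickening_iff.1 (hR p hp).1
    have hzq := Metric.mem_ball.1 ((hR p hp).2.2.2.1 hz)
    exact Metric.mem_thickening_iff.2 ⟨x, hx, by linarith [dist_triangle z (q p) x]⟩
  rw [measure_biUnion_finset hdisj fun p hp => (hR p hp).2.2.1.measurableSet] at h2
  refine (ENNReal.ofReal_le_ofReal_iff (P.waste_nonneg _)).1 (le_trans ?_ h2)
  rw [ENNReal.ofReal_mul (by norm_num)]
  refine (mul_le_mul_right h1 _).trans ?_
  rw [Finset.mul_sum]
  refine Finset.sum_le_sum fun p hp => ?_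
  rw [← ENNReal.ofReal_mul (by norm_num)]
  exact (hR p hp).2.2.2.2.2

end Packing

theorem mainTheorem3 (S₀ : Square) (hS₀ : S₀.angle = 0) (P : Packing S₀)
    (a b : Option (Fin P.count)) (s t : ℝ) (hst : s < t)
    (γ : ℝ → Plane) (hγ : ContinuousOn γ (Set.Icc s t))
    (ha : γ s ∈ P.star a) (hb : γ t ∈ P.star b) :
    ((1 / 10 ^ 10 : ℝ) / 1600) * (P.square a).theta (P.square b) ≤
      P.waste (Metric.thickening 5 (γ '' Set.Icc s t)) := by
  have hW : 0 ≤ P.waste (Metric.thickening 5 (γ '' Set.Icc s t)) :=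
    P.waste_nonneg _
  by_cases hab : a = b
  · rw [hab, Square.theta_self, mul_zero]
    exact hW
  obtain ⟨i₀⟩ : Nonempty (Fin P.count) := by
    cases a with
    | some i => exact ⟨i⟩
    | none =>
      cases b with
      | some i => exact ⟨i⟩
      | none => exact absurd rfl hab
  by_contra! hcon
  have hθ := (P.square a).theta_le_pi_div_four (P.square b)
  have hpi := Real.pi_pos
  -- This ρ is small enough for 400ρ ≤ 1/2400, and πρ² still exceeds the claimed bound at angle π/4.
  have h := P.mul_theta_le_waste i₀ (isPreconnected_Icc.image γ hγ) (ρ := 1 / 10 ^ 6)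
    (by norm_num) le_rfl (fun q hq => P.exists_star_inter_ball
    (A := Metric.thickening 5 (γ '' Set.Icc s t)) (by norm_num) (fun z hz => ?_) ?_)
    (a := a) (b := b) ⟨γ s, mem_image_of_mem γ (left_mem_Icc.2 hst.le), ha⟩
    ⟨γ t, mem_image_of_mem γ (right_mem_Icc.2 hst.le), hb⟩
  · linarith
  · obtain ⟨x, hx, hqx⟩ := Metric.mem_thickening_iff.1 hq
    have hzq := Metric.mem_ball.1 hz
    exact Metric.mem_thickening_iff.2 ⟨x, hx, by linarith [dist_triangle z q x]⟩
  · linarith
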